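/- Model. The $m\times n$ grid has nodes $v_{i,j}$ ($0\le i<m$, $0\le j<n$), adjacent iff $|i-i'|+|j-j'|=1$. Each of $k$ robots is on a node and carries a light with a color from a finite set $Col$. A configuration assigns to each node the multiset of colors of the robots on it. A robot with visible distance $\phi=1$ sees its own color, the multiset of colors on its own node, and, for each of the four adjacent positions, the multiset of colors there ($\emptyset$ if the node is empty) or $\bot$ if the node does not exist; without a common chirality it obtains the eight versions of this view under rotations and reflections of the square. An algorithm is a finite set of rules. A rule consists of a guard (the robot's own color, the multiset on its own node, and for each of the four adjacent positions either a required multiset, or "$\bot$", or "$\emptyset$ or $\bot$") and an action (a new color, and staying or moving to an adjacent position whose existence is ensured by the guard). A robot is enabled if one of its views matches the guard of a rule. In the ASYNC model, time is $0,1,2,\dots$; each robot starts with a Look phase and then cyclically executes the phases Look (take a snapshot of the current configuration), Compute (choose a rule together with a view of that, possibly outdated, snapshot that matches it, and take the new color; do nothing if there is none) and Move (make the decided movement, in the direction given by the matched view). At each instant an arbitrary set of robots is activated by the scheduler and each of them executes its next phase; each robot is activated infinitely often; when several rules or views match, the scheduler selects one. An execution is a terminating exploration if every node is visited by at least one robot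 and from some instant on no robot is enabled. Statement. Let $Col=\{\mathsf G,\mathsf W,\mathsf B\}$. There is an algorithm $A$ for visible distance $\phi=1$ with colors $Col$ (not depending on $m,n$) such that, for all $m\ge 3$ and $n\ge 3$, every execution of $A$ by six robots on the $m\times n$ grid in the ASYNC model without common chirality from the initial configuration $$\{(v_{0,0},\{\mathsf G\}),(v_{0,1},\{\mathsf W\}),(v_{0,2},\{\mathsf W\}),(v_{1,0},\{\mathsf W,\mathsf B\}),(v_{1,1},\{\mathsf W\})\}$$ is a terminating exploration. -/

import Mathlib

namespace GridExploration

/-! ### Grids and directions -/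

/-- The nodes `v i j` of the `m × n` grid: row `i` (growing southwards), column `j` (growing
eastwards). -/
abbrev Node (m n : ℕ) : Type := Fin m × Fin n

inductive Dir : Type
  | north | east | south | west
  deriving DecidableEq

/-- The node next to `v` in direction `d`; `none` if there is no such node in the grid. -/
def neighbor {m n : ℕ} (v : Node m n) : Dir → Option (Node m n)
  | .north =>
      if 0 < v.1.val then
        some (⟨v.1.val - 1, Nat.lt_of_le_of_lt (Nat.sub_le _ _) v.1.isLt⟩, v.2)
      else none
  | .south => if h : v.1.val + 1 < m then some (⟨v.1.val + 1, h⟩, v.2) else none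
  | .west =>
      if 0 < v.2.val then
        some (v.1, ⟨v.2.val - 1, Nat.lt_of_le_of_lt (Nat.sub_le _ _) v.2.isLt⟩)
      else none
  | .east => if h : v.2.val + 1 < n then some (v.1, ⟨v.2.val + 1, h⟩) else none

/-- Clockwise quarter turn. -/
def Dir.rotate : Dir → Dir
  | .north => .east
  | .east => .south
  | .south => .west
  | .west => .north

/-- Reflection exchanging east and west. -/
def Dir.mirror : Dir → Dir
  | .north => .north
  | .east => .west
  | .south => .south
  | .west => .east

/-- The eight ways a robot without compass and without chirality may be oriented: a number of
clockwise quarter turns, and whether the picture is mirrored. -/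
structure Orientation : Type where
  turns : Fin 4
  mirrored : Bool
  deriving DecidableEq

/-- The global direction which a robot with orientation `o` perceives as its direction `d`. -/
def Orientation.toGlobal (o : Orientation) (d : Dir) : Dir :=
  Dir.rotate^[o.turns.val] (if o.mirrored then d.mirror else d)

/-! ### Configurations and views (visible distance one) -/

/-- A configuration: for each node the multiset of colors of the robots on it (`0` if the node is
not occupied). -/
abbrev Configuration (Col : Type) (m n : ℕ) : Type := Node m n → Multiset Col

/-- A view at visible distance one: the color of the robot itself, the multiset of colors on its
own node, and the contents of the four adjacent nodes, `none` standing for a node that does not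
exist. -/
structure View (Col : Type) : Type where
  color : Col
  center : Multiset Col
  around : Dir → Option (Multiset Col)

/-- The view of a robot with color `c` on the node `v`, in the frame of the global directions (the
north view). -/
def Configuration.view {Col : Type} {m n : ℕ} (C : Configuration Col m n) (v : Node m n) (c : Col) :
    View Col where
  color := c
  center := C v
  around := fun d => (neighbor v d).map C

/-- The same view as perceived under the orientation `o`. As `o` varies, these are the eight views
obtained by a robot when there is no common chirality. -/
def View.orient {Col : Type} (V : View Col) (o : Orientation) : View Col where
  color := V.color
  center := V.center
  around := fun d => V.around (o.toGlobal d)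

/-! ### Algorithms -/

/-- The condition that a guard puts on one adjacent node: the node exists and hosts exactly the
multiset `M` of colors (`M = 0`: the node is empty); the node does not exist; or the node is empty
or does not exist. -/
inductive CellGuard (Col : Type) : Type
  | hosts (M : Multiset Col)
  | absent
  | emptyOrAbsent

def CellGuard.Accepts {Col : Type} : CellGuard Col → Option (Multiset Col) → Prop
  | .hosts M, x => x = some M
  | .absent, x => x = none
  | .emptyOrAbsent, x => x = some 0 ∨ x = none

/-- A rule: a guard (`color`, `center`, `around`), and an action (`newColor`, and a movement, `none`
meaning that the robot does not move). A rule may only prescribe a movement towards a node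
whose existence is ensured by the guard. -/
structure Rule (Col : Type) : Type where
  color : Col
  center : Multiset Col
  around : Dir → CellGuard Col
  newColor : Col
  movement : Option Dir
  target_exists : ∀ d, movement = some d → ∃ M, around d = CellGuard.hosts M

def Rule.Matches {Col : Type} (R : Rule Col) (V : View Col) : Prop :=
  V.color = R.color ∧ V.center = R.center ∧ ∀ d, (R.around d).Accepts (V.around d)

/-- An algorithm is a finite set of rules (the order in the list plays no role). -/
abbrev Algorithm (Col : Type) : Type := List (Rule Col)

/-- The rule `R` of `A` can be applied to the snapshot `V` using the orientation `o`. -/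
def Algorithm.Applicable {Col : Type} (A : Algorithm Col) (V : View Col) (R : Rule Col)
    (o : Orientation) : Prop :=
  R ∈ A ∧ R.Matches (V.orient o)

/-! ### Asynchronous executions -/

/-- The phase that a robot is going to execute next, with what it remembers inside its current
cycle: the snapshot taken in the Look phase, then the movement (in global directions) decided in
the Compute phase. -/
inductive Phase (Col : Type) : Type
  | look
  | compute (snapshot : View Col)
  | move (d : Option Dir)

structure RobotState (Col : Type) (m n : ℕ) : Type where
  pos : Node m n
  color : Col
  phase : Phase Col

/-- The state of a system of `k` robots. The numbering serves to describe schedulers only; robots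
have no access to it. -/
abbrev SystemState (Col : Type) (k m n : ℕ) : Type := Fin k → RobotState Col m n

def SystemState.configuration {Col : Type} {k m n : ℕ} (s : SystemState Col k m n) :
    Configuration Col m n :=
  fun v => ((Finset.univ.filter fun r => (s r).pos = v).val).map fun r => (s r).color

/-- The current view of robot `r`. -/
def SystemState.view {Col : Type} {k m n : ℕ} (s : SystemState Col k m n) (r : Fin k) : View Col :=
  Configuration.view (SystemState.configuration s) (s r).pos (s r).color

/-- Robot `r` is enabled: some view of `r` in the current configuration matches some rule. -/
def Enabled {Col : Type} {k m n : ℕ} (A : Algorithm Col) (s : SystemState Col k m n) (r : Fin k) :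
    Prop :=
  ∃ R o, Algorithm.Applicable A (SystemState.view s r) R o

/-- The node reached from `v` by the movement `d`. (A movement towards a missing node never arises
from a rule, see `Rule.target_exists`.) -/
def moveTo {m n : ℕ} (v : Node m n) : Option Dir → Node m n
  | none => v
  | some d => (neighbor v d).getD v

/-- `x` is a possible state of robot `r` after it executes its next phase in the system state `s`.
In the Compute phase, one applicable combination of a rule and a view is selected arbitrarily (by
the scheduler), the color is changed at the end of this phase, and the robot does nothing if
no rule is applicable to its, possibly outdated, snapshot. -/
inductive RobotStep {Col : Type} {k m n : ℕ} (A : Algorithm Col) (s : SystemState Col k m n)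
    (r : Fin k) (x : RobotState Col m n) : Prop
  | look (hp : (s r).phase = .look)
      (hx : x = { s r with phase := .compute (SystemState.view s r) })
  | compute (V : View Col) (R : Rule Col) (o : Orientation) (hp : (s r).phase = .compute V)
      (hR : Algorithm.Applicable A V R o)
      (hx : x = { pos := (s r).pos
                  color := R.newColor
                  phase := .move (R.movement.map o.toGlobal) })
  | computeIdle (V : View Col) (hp : (s r).phase = .compute V)
      (hR : ¬ ∃ R o, Algorithm.Applicable A V R o)
      (hx : x = { s r with phase := .move none })
  | move (d : Option Dir) (hp : (s r).phase = .move d)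
      (hx : x = { pos := moveTo (s r).pos d
                  color := (s r).color
                  phase := .look })

/-- An execution of `A` by `k` robots on the `m × n` grid in the ASYNC model under a fair scheduler:
at each instant `t` the scheduler activates an arbitrary set of robots, each of which executes its
next phase between `t` and `t + 1`, all of them based on the situation at instant `t`; each robot is
activated infinitely often. -/
structure AsyncExecution {Col : Type} (A : Algorithm Col) (k m n : ℕ) : Type where
  state : ℕ → SystemState Col k m n
  activated : ℕ → Set (Fin k)
  start : ∀ r, (state 0 r).phase = .look
  step_activated : ∀ t, ∀ r ∈ activated t, RobotStep A (state t) r (state (t + 1) r)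
  step_other : ∀ t, ∀ r ∉ activated t, state (t + 1) r = state t r
  fair : ∀ r, ∀ t, ∃ t', t ≤ t' ∧ r ∈ activated t'

/-- Terminating exploration: every node is visited by at least one robot, and from some instant on
no robot is enabled. -/
def AsyncExecution.IsTerminatingExploration {Col : Type} {A : Algorithm Col} {k m n : ℕ}
    (E : AsyncExecution A k m n) : Prop :=
  (∀ v : Node m n, ∃ t r, (E.state t r).pos = v) ∧
    ∃ T, ∀ t, T ≤ t → ∀ r, ¬ Enabled A (E.state t) r

/-- In the ASYNC model with visible distance one and without common chirality, `A` solves the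
terminating exploration of the `m × n` grid by `k` robots from the initial configuration `C₀`. -/
def SolvesTerminatingExploration {Col : Type} (A : Algorithm Col) (k : ℕ) {m n : ℕ}
    (C₀ : Configuration Col m n) : Prop :=
  ∀ E : AsyncExecution A k m n, SystemState.configuration (E.state 0) = C₀ →
    E.IsTerminatingExploration

/-! ### Three colors and the initial configuration -/

inductive Color : Type
  | G | W | B
  deriving DecidableEq

/-- Six robots at the northwest corner of the grid:
`{(v 0 0, {G}), (v 0 1, {W}), (v 0 2, {W}), (v 1 0, {W, B}), (v 1 1, {W})}`. -/
def initialConfiguration (m n : ℕ) : Configuration Color m n := fun v =>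
  match v.1.val, v.2.val with
  | 0, 0 => {Color.G}
  | 0, 1 => {Color.W}
  | 0, 2 => {Color.W}
  | 1, 0 => {Color.W, Color.B}
  | 1, 1 => {Color.W}
  | _, _ => 0

end GridExploration

/-! The algorithm `explorer` is built so that, along its run, exactly one robot is enabled at each
step, all rules and views that match for that robot give the same action, and this action is either
a change of color or a movement, never both. Asynchrony is then harmless. Robots that are not
enabled take only snapshots on which they cannot act, and the visible configuration stays fixed
until the enabled robot completes its action, so a snapshot on which it acts is never outdated.
Hence every fair ASYNC execution goes through the same sequence of configurations, up to the naming
of the robots (`AsyncExecution.exists_tracks_of_step`), and it suffices to follow one deterministic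
run (`solves_of_reach`).

That run is handled uniformly in `m` and `n` because robots see only adjacent nodes. What happens in
a small box depends only on its content and on which of its sides lie on the border, provided that
all other robots are apart from it. Finitely many box runs are checked by evaluation and transferred
to the grid by `reach_of_boxReaches`.

They are glued by induction. Moving the three-robot shuttle by one column and turning it at the east
border give a whole row (`reach_row`). The passages between rows carry the shuttle and its marker
downwards (`reach_departure`). When the southmost row has been explored, no rule matches any more
(`exists_reach_idle`). -/

namespace GridExploration

/-! ### The algorithm -/

/-- The guards on the four adjacent nodes, listed clockwise from the north. -/
def guards (n e s w : CellGuard Color) : Dir → CellGuard Color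
  | .north => n
  | .east => e
  | .south => s
  | .west => w

/-- A rule that only changes the color. -/
def recolor (c : Color) (center : Multiset Color) (n e s w : CellGuard Color) (c' : Color) :
    Rule Color where
  color := c
  center := center
  around := guards n e s w
  newColor := c'
  movement := none
  target_exists := fun _ h => by cases h

/-- A rule that only moves the robot, forwards, onto a node hosting `M`; `e`, `s` and `w` are the
guards on the nodes to the right, behind, and to the left. -/
def advance (c : Color) (center M : Multiset Color) (e s w : CellGuard Color) : Rule Color where
  color := c
  center := center
  around := guards (.hosts M) e s w
  newColor := c
  movement := some .north
  target_exists := fun _ h => by cases h; exact ⟨M, rfl⟩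

open Color CellGuard in
/-- A shuttle of three robots of different colors travels along a row, from the west border to the
east border and back, while a marker robot waits on the westmost node of the previous
row. Once the shuttle is back, the four robots shift to the next row. Two robots of color `B` are
left behind on the second node of the northmost row. -/
def explorer : Algorithm Color :=
  [ -- travelling along a row
   advance G {G} {W} emptyOrAbsent emptyOrAbsent emptyOrAbsent,
   advance B {W, B} 0 emptyOrAbsent (hosts {G}) emptyOrAbsent,
   advance W {G, W} {B} emptyOrAbsent emptyOrAbsent emptyOrAbsent,
   -- turning back at the east border
   recolor B {W, B} absent emptyOrAbsent (hosts {G}) emptyOrAbsent G,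
   recolor G {G} (hosts {G, W}) emptyOrAbsent emptyOrAbsent emptyOrAbsent B,
   -- the same below the two robots left behind
   advance G {G} {W} (hosts {B, B}) emptyOrAbsent emptyOrAbsent,
   advance B {W, B} 0 (hosts {B, B}) (hosts {G}) emptyOrAbsent,
   advance W {G, W} {B} (hosts {B, B}) emptyOrAbsent emptyOrAbsent,
   recolor G {G} (hosts {G, W}) (hosts {B, B}) emptyOrAbsent emptyOrAbsent B,
   -- shifting to the next row
   advance B {W, B} 0 absent (hosts {W}) (hosts {G}),
   recolor W {G, W} (hosts {W}) emptyOrAbsent (hosts {B}) absent B,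
   advance W {W} {G, B} absent emptyOrAbsent emptyOrAbsent,
   advance W {W} {G, B} absent emptyOrAbsent (hosts {B, B}),
   advance W {G, W, B} {B} absent (hosts 0) emptyOrAbsent,
   advance B {W, B} 0 (hosts 0) absent (hosts {G, B}),
   recolor B {G, B} emptyOrAbsent emptyOrAbsent (hosts {W}) absent W,
   advance G {G, W} {W} absent emptyOrAbsent emptyOrAbsent,
   advance G {G, W} {W} absent emptyOrAbsent (hosts {B, B}),
   advance W {G, W} {B} (hosts 0) absent (hosts {W}),
   advance G {G} {W} (hosts 0) absent (hosts {W}),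
   -- entering the southmost row
   recolor W {W, B} (hosts {G, B}) (hosts 0) absent absent G,
   advance B {G, B} 0 absent absent (hosts {G, B}),
   advance B {G, B} {G} absent (hosts 0) (hosts 0),
   recolor G {G, B} (hosts {G}) (hosts {B}) absent absent W,
   advance W {W, B} {B} absent absent (hosts {G}),
   recolor B {B} (hosts {G}) (hosts {W, B}) absent absent G,
   advance G {G} {W} absent absent (hosts {G}),
   -- forming the shuttle in the northmost row
   recolor W {W, B} (hosts {G}) (hosts {W}) (hosts 0) absent G,
   recolor G {G} absent (hosts {W}) (hosts {G, B}) absent B,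
   recolor W {W} absent (hosts {W}) (hosts {W}) (hosts {B}) B,
   advance W {W} {B} (hosts 0) (hosts 0) (hosts {G, B}),
   advance B {W, B} {W} emptyOrAbsent (hosts {B}) absent,
   recolor W {W} absent (hosts {W, B}) emptyOrAbsent (hosts {B}) G,
   advance G {G} {W} emptyOrAbsent (hosts {B}) absent,
   recolor G {G} (hosts {G, W}) emptyOrAbsent (hosts {B}) absent B,
   -- forming the shuttle in the next row
   recolor W {W, B} absent (hosts {G}) emptyOrAbsent (hosts {B}) B,
   advance G {G} {B, B} emptyOrAbsent emptyOrAbsent emptyOrAbsent,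
   advance G {G, B, B} {B} emptyOrAbsent emptyOrAbsent emptyOrAbsent,
   recolor B {G, B} absent (hosts {B, B}) (hosts {G, B}) absent W,
   recolor G {G, B} (hosts {G, W}) (hosts 0) (hosts 0) absent W,
   advance B {W, B} 0 (hosts 0) absent (hosts {G, W})]

/-! ### Executable matching -/

def orientations : List Orientation :=
  [⟨0, false⟩, ⟨1, false⟩, ⟨2, false⟩, ⟨3, false⟩, ⟨0, true⟩, ⟨1, true⟩, ⟨2, true⟩, ⟨3, true⟩]

theorem mem_orientations (o : Orientation) : o ∈ orientations := by
  obtain ⟨t, b⟩ := o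
  fin_cases t <;> cases b <;> simp [orientations]

def CellGuard.accepts : CellGuard Color → Option (Multiset Color) → Bool
  | .hosts M, some N => decide (N = M)
  | .hosts _, none => false
  | .absent, some _ => false
  | .absent, none => true
  | .emptyOrAbsent, some N => decide (N = 0)
  | .emptyOrAbsent, none => true

theorem CellGuard.accepts_iff (g : CellGuard Color) (x : Option (Multiset Color)) :
    g.accepts x = true ↔ g.Accepts x := by
  cases g <;> cases x <;> simp [CellGuard.accepts, CellGuard.Accepts]

def Rule.matchesView (R : Rule Color) (V : View Color) : Bool :=
  decide (V.color = R.color) && decide (V.center = R.center) &&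
    (R.around .north).accepts (V.around .north) && (R.around .east).accepts (V.around .east) &&
    (R.around .south).accepts (V.around .south) && (R.around .west).accepts (V.around .west)

theorem Rule.matchesView_iff (R : Rule Color) (V : View Color) :
    R.matchesView V = true ↔ R.Matches V := by
  simp only [Rule.matchesView, Rule.Matches, Bool.and_eq_true, decide_eq_true_eq,
    CellGuard.accepts_iff, and_assoc]
  refine and_congr_right fun _ => and_congr_right fun _ => ⟨?_, fun h => ⟨h _, h _, h _, h _⟩⟩
  rintro ⟨hn, he, hs, hw⟩ (_ | _ | _ | _) <;> assumption

/-- All pairs of a new color and a global movement that a robot with view `V` may choose. -/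
def actions (A : Algorithm Color) (V : View Color) : List (Color × Option Dir) :=
  -- Color and center do not depend on the orientation; testing them before the eight orientations
  -- keeps the later evaluations short.
  A.flatMap fun R => if decide (V.color = R.color) && decide (V.center = R.center) then
    (orientations.filter fun o => R.matchesView (V.orient o)).map fun o =>
      (R.newColor, R.movement.map o.toGlobal) else []

theorem mem_actions {A : Algorithm Color} {V : View Color} {x : Color × Option Dir} :
    x ∈ actions A V ↔
      ∃ R o, Algorithm.Applicable A V R o ∧ x = (R.newColor, R.movement.map o.toGlobal) := by
  simp only [actions, List.mem_flatMap, Algorithm.Applicable]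
  constructor
  · rintro ⟨R, hR, h⟩
    split_ifs at h
    · obtain ⟨o, ho, rfl⟩ := List.mem_map.1 h
      exact ⟨R, o, ⟨hR, (R.matchesView_iff _).1 (List.mem_filter.1 ho).2⟩, rfl⟩
    · cases h
  · rintro ⟨R, o, ⟨hR, h⟩, rfl⟩
    refine ⟨R, hR, ?_⟩
    have hc : V.color = R.color := h.1
    have hm : V.center = R.center := h.2.1
    simp only [hc, hm, decide_true, Bool.and_self, if_true]
    exact List.mem_map.2
      ⟨o, List.mem_filter.2 ⟨mem_orientations o, (R.matchesView_iff _).2 h⟩, rfl⟩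

/-! ### Patterns in a box -/

/-- A robot of a given color on the node with the given coordinates. -/
abbrev Token : Type := ℕ × ℕ × Color

/-- Which sides of a box do not lie on the border of the grid. -/
structure Margins : Type where
  north : Bool
  east : Bool
  south : Bool
  west : Bool

def colorsAt (P : List Token) (x y : ℕ) : Multiset Color :=
  ((P.filter fun p => decide (p.1 = x) && decide (p.2.1 = y)).map fun p => p.2.2 : List Color)

/-- The view of the token `p` of a pattern `P` in a box of `h` rows and `w` columns. -/
def boxView (h w : ℕ) (μ : Margins) (P : List Token) (p : Token) : View Color where
  color := p.2.2
  center := colorsAt P p.1 p.2.1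
  around
    | .north => if 0 < p.1 then some (colorsAt P (p.1 - 1) p.2.1)
        else if μ.north then some 0 else none
    | .east => if p.2.1 + 1 < w then some (colorsAt P p.1 (p.2.1 + 1))
        else if μ.east then some 0 else none
    | .south => if p.1 + 1 < h then some (colorsAt P (p.1 + 1) p.2.1)
        else if μ.south then some 0 else none
    | .west => if 0 < p.2.1 then some (colorsAt P p.1 (p.2.1 - 1))
        else if μ.west then some 0 else none

/-- No token of `Q` can act in the pattern `P`. -/
def boxIdle (h w : ℕ) (μ : Margins) (P Q : List Token) : Bool :=
  Q.all fun q => (actions explorer (boxView h w μ P q)).isEmpty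

def inBox (h w : ℕ) (P : List Token) : Bool :=
  P.all fun p => decide (p.1 < h) && decide (p.2.1 < w)

/-- The token obtained from `p` by an action that is a movement within the box or a change of
color, but not both. -/
def actOn (h w : ℕ) (p : Token) : Color × Option Dir → Option Token
  | (c, none) => some (p.1, p.2.1, c)
  | (c, some d) =>
    if c = p.2.2 then
      match d with
      | .north => if 0 < p.1 then some (p.1 - 1, p.2.1, c) else none
      | .east => if p.2.1 + 1 < w then some (p.1, p.2.1 + 1, c) else none
      | .south => if p.1 + 1 < h then some (p.1 + 1, p.2.1, c) else none
      | .west => if 0 < p.2.1 then some (p.1, p.2.1 - 1, c) else none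
    else none

/-- `P` has exactly one token that can act, this token has only one possible action, and `P'` is
the result. Here the token is looked for behind the prefix `S` of `P`. -/
def boxNextAux (h w : ℕ) (μ : Margins) (S : List Token) : List Token → Option (List Token)
  | [] => none
  | p :: T =>
    match actions explorer (boxView h w μ (p :: (S ++ T)) p) with
    | [] => boxNextAux h w μ (p :: S) T
    | a :: l =>
      -- A symmetric view matches a rule under several orientations. This is harmless as long as all
      -- matches yield the same color and the same global movement.
      if l.all (fun b => decide (b = a)) && boxIdle h w μ (p :: (S ++ T)) (S ++ T) then
        (actOn h w p a).map fun p' => p' :: (S ++ T)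
      else none

def boxNext (h w : ℕ) (μ : Margins) (P : List Token) : Option (List Token) :=
  if inBox h w P then boxNextAux h w μ [] P else none

def boxRun (h w : ℕ) (μ : Margins) : ℕ → List Token → Option (List Token)
  | 0, P => some P
  | k + 1, P => (boxNext h w μ P).bind (boxRun h w μ k)

/-- After `k` steps the pattern `P` has become `P'`, up to the order of the tokens. -/
def boxReaches (h w : ℕ) (μ : Margins) (k : ℕ) (P P' : List Token) : Bool :=
  match boxRun h w μ k P with
  | some R => R.isPerm P'
  | none => false


/-! ### Configurations as multisets of tokens -/

/-- The colors of the tokens of `L` on the node with coordinates `x`, `y`. -/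
def colorsIn (L : Multiset Token) (x y : ℕ) : Multiset Color :=
  (L.filter fun p => p.1 = x ∧ p.2.1 = y).map fun p => p.2.2

/-- The view of a robot represented by the token `p` on the `m × n` grid. -/
def gridView (m n : ℕ) (L : Multiset Token) (p : Token) : View Color where
  color := p.2.2
  center := colorsIn L p.1 p.2.1
  around
    | .north => if 0 < p.1 then some (colorsIn L (p.1 - 1) p.2.1) else none
    | .east => if p.2.1 + 1 < n then some (colorsIn L p.1 (p.2.1 + 1)) else none
    | .south => if p.1 + 1 < m then some (colorsIn L (p.1 + 1) p.2.1) else none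
    | .west => if 0 < p.2.1 then some (colorsIn L p.1 (p.2.1 - 1)) else none

section Tokens

variable {k m n : ℕ}

def RobotState.token (x : RobotState Color m n) : Token := (x.pos.1.val, x.pos.2.val, x.color)

def SystemState.tokens (s : SystemState Color k m n) : Multiset Token :=
  Finset.univ.val.map fun r => (s r).token

theorem SystemState.configuration_apply (s : SystemState Color k m n) (v : Node m n) :
    SystemState.configuration s v = colorsIn (SystemState.tokens s) v.1.val v.2.val := by
  simp only [SystemState.configuration, colorsIn, SystemState.tokens, Multiset.filter_map,
    Multiset.map_map, Finset.filter_val]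
  congr 1
  refine Multiset.filter_congr fun r _ => ?_
  simp [RobotState.token, Prod.ext_iff, Fin.ext_iff]

theorem SystemState.view_eq (s : SystemState Color k m n) (r : Fin k) :
    SystemState.view s r = gridView m n (SystemState.tokens s) (s r).token := by
  unfold SystemState.view Configuration.view gridView
  congr 1
  · exact SystemState.configuration_apply s _
  · funext d
    cases d <;> simp only [neighbor, RobotState.token] <;> split_ifs with h <;>
      simp [SystemState.configuration_apply, h]

/-- In the configuration `L` exactly one robot is enabled, it has only one possible action, and this
action leads to `L'`. -/
def Step (A : Algorithm Color) (m n : ℕ) (L L' : Multiset Token) : Prop :=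
  ∃ p p' T a, L = p ::ₘ T ∧ L' = p' ::ₘ T ∧ actOn m n p a = some p' ∧
    (actions A (gridView m n L p) ≠ [] ∧ ∀ b ∈ actions A (gridView m n L p), b = a) ∧
    ∀ q ∈ T, actions A (gridView m n L q) = []

/-- In the configuration `L` no robot of `Q` is enabled. -/
def Idle (A : Algorithm Color) (m n : ℕ) (L Q : Multiset Token) : Prop :=
  ∀ q ∈ Q, actions A (gridView m n L q) = []

/-! ### Executions follow the steps -/

/-- The robot remembers nothing that could make it act before its next Look phase. -/
def Phase.Inactive (A : Algorithm Color) : Phase Color → Prop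
  | .look => True
  | .compute V => actions A V = []
  | .move d => d = none

/-- The configuration is `L`, and no robot is going to act before its next Look phase. -/
def Tracks (A : Algorithm Color) (s : SystemState Color k m n) (L : Multiset Token) : Prop :=
  SystemState.tokens s = L ∧ ∀ r, (s r).phase.Inactive A

/-- Every robot executes its next phase or keeps its state. -/
def Transition (A : Algorithm Color) (s s' : SystemState Color k m n) : Prop :=
  ∀ r, RobotStep A s r (s' r) ∨ s' r = s r

theorem enabled_iff {A : Algorithm Color} {s : SystemState Color k m n} {r : Fin k} :
    Enabled A s r ↔ actions A (SystemState.view s r) ≠ [] := by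
  rw [Enabled, List.ne_nil_iff_exists_cons]
  constructor
  · rintro ⟨R, o, h⟩
    exact List.exists_cons_of_ne_nil (List.ne_nil_of_mem (mem_actions.2 ⟨R, o, h, rfl⟩))
  · rintro ⟨a, l, h⟩
    obtain ⟨R, o, hR, -⟩ := mem_actions.1 (h ▸ List.mem_cons_self : a ∈ actions A _)
    exact ⟨R, o, hR⟩

/-- A new snapshot is harmless because the robot is not enabled now, and an old one because of
`Phase.Inactive`. -/
theorem RobotStep.of_not_enabled {A : Algorithm Color} {s : SystemState Color k m n} {r : Fin k}
    {x : RobotState Color m n} (hr : actions A (SystemState.view s r) = [])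
    (hp : (s r).phase.Inactive A) (h : RobotStep A s r x) :
    x.token = (s r).token ∧ x.phase.Inactive A := by
  rcases h with ⟨hq, rfl⟩ | ⟨V, R, o, hq, hR, rfl⟩ | ⟨V, hq, hR, rfl⟩ | ⟨d, hq, rfl⟩
  · exact ⟨rfl, hr⟩
  · rw [hq] at hp
    have := mem_actions.2 ⟨R, o, hR, rfl⟩
    rw [show actions A V = [] from hp] at this
    cases this
  · exact ⟨rfl, rfl⟩
  · rw [hq] at hp
    cases (show d = none from hp)
    exact ⟨rfl, trivial⟩

/-- Robot `r` is the only enabled robot, its only action is `a`, and it has not yet completed it. -/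
structure Focus (A : Algorithm Color) (s : SystemState Color k m n) (r : Fin k)
    (a : Color × Option Dir) : Prop where
  enabled : actions A (SystemState.view s r) ≠ []
  action : ∀ b ∈ actions A (SystemState.view s r), b = a
  others : ∀ q, q ≠ r → actions A (SystemState.view s q) = [] ∧ (s q).phase.Inactive A
  phase : (s r).phase.Inactive A ∨ (s r).phase = .compute (SystemState.view s r) ∨
    ((s r).phase = .move a.2 ∧ (s r).color = a.1)

theorem SystemState.view_congr {s s' : SystemState Color k m n}
    (h : ∀ q, (s' q).token = (s q).token) (r : Fin k) :
    SystemState.view s' r = SystemState.view s r := by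
  rw [SystemState.view_eq, SystemState.view_eq, h r]
  simp only [SystemState.tokens, h]

theorem actOn_some_color {h w : ℕ} {p p' : Token} {c : Color} {d : Dir}
    (hp : actOn h w p (c, some d) = some p') : c = p.2.2 := by
  by_contra hc
  simp [actOn, hc] at hp

theorem moveTo_token {x : RobotState Color m n} {p' : Token} {d : Option Dir} {ph : Phase Color}
    (h : actOn m n x.token (x.color, d) = some p') :
    (RobotState.mk (moveTo x.pos d) x.color ph).token = p' := by
  rcases d with _ | _ | _ | _ | _ <;>
    simp only [actOn, RobotState.token, moveTo, neighbor, if_true] at h ⊢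
  · simpa using h
  all_goals
    rcases ite_eq_iff.1 h with ⟨h1, h2⟩ | ⟨h1, h2⟩
    · simpa [h1] using h2
    · cases h2

open Classical in
/-- An upper bound for the number of phases that the enabled robot still has to execute. -/
def Phase.delay (A : Algorithm Color) : Phase Color → ℕ
  | .move (some _) => 0
  | .compute V => if actions A V = [] then 4 else 1
  | .look => 2
  | .move none => 3

/-- As long as the action is not completed, no token changes, so all views stay the same and a
pending snapshot or movement of `r` remains valid. The hypothesis `ha` excludes a simultaneous
change of color and movement, whose intermediate configuration would be visible to the others. -/
theorem Focus.transition {A : Algorithm Color} {s s' : SystemState Color k m n} {r : Fin k}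
    {a : Color × Option Dir} {p' : Token} (hF : Focus A s r a)
    (ha : actOn m n (s r).token a = some p') (hs : Transition A s s') :
    (∀ q, q ≠ r → (s' q).token = (s q).token ∧ (s' q).phase.Inactive A) ∧
    (((s' r).token = p' ∧ (s' r).phase.Inactive A) ∨
      ((s' r).token = (s r).token ∧ Focus A s' r a ∧
        (s' r = s r ∨ (s' r).phase.delay A < (s r).phase.delay A))) := by
  have hO : ∀ q, q ≠ r → (s' q).token = (s q).token ∧ (s' q).phase.Inactive A := by
    intro q hq
    rcases hs q with h | h
    · exact h.of_not_enabled (hF.others q hq).1 (hF.others q hq).2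
    · rw [h]; exact ⟨rfl, (hF.others q hq).2⟩
  refine ⟨hO, ?_⟩
  have key : (s' r).token = (s r).token → ((s' r).phase.Inactive A ∨
      (s' r).phase = .compute (SystemState.view s r) ∨
      ((s' r).phase = .move a.2 ∧ (s' r).color = a.1)) → Focus A s' r a := by
    intro ht hph
    have hv := SystemState.view_congr (s := s) (s' := s') fun q => by
      by_cases hq : q = r
      · rw [hq, ht]
      · exact (hO q hq).1
    refine ⟨hv r ▸ hF.enabled, hv r ▸ hF.action, fun q hq => ⟨?_, (hO q hq).2⟩, hv r ▸ hph⟩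
    rw [hv q]; exact (hF.others q hq).1
  rcases hs r with h | h
  swap
  · refine Or.inr ⟨by rw [h], key (by rw [h]) ?_, Or.inl h⟩
    rw [h]; exact hF.phase
  rcases h with ⟨hq, hx⟩ | ⟨V, R, o, hq, hR, hx⟩ | ⟨V, hq, hR, hx⟩ | ⟨d, hq, hx⟩
  · right
    refine ⟨by rw [hx]; rfl, key (by rw [hx]; rfl) (by rw [hx]; simp), Or.inr ?_⟩
    rw [hx, hq]
    simp [Phase.delay, hF.enabled]
  · have hmem := mem_actions.2 ⟨R, o, hR, rfl⟩
    have hV : V = SystemState.view s r := by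
      have := hF.phase
      rw [hq] at this
      rcases this with h | h | h
      · rw [show actions A V = [] from h] at hmem; cases hmem
      · exact Phase.compute.inj h
      · cases h.1
    have haeq := hF.action _ (hV ▸ hmem)
    obtain ⟨c, d⟩ := a
    obtain ⟨hc, hd⟩ := Prod.mk.inj haeq
    rw [hc, hd] at hx
    rcases d with _ | d
    · left
      rw [hx]
      refine ⟨?_, rfl⟩
      simpa [actOn, RobotState.token] using ha
    · right
      -- The action is a movement, so it keeps the color: Compute changes nothing that is visible.
      have hcol : c = (s r).color := actOn_some_color ha
      refine ⟨by rw [hx, hcol]; rfl, key (by rw [hx, hcol]; rfl) (by rw [hx]; simp), Or.inr ?_⟩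
      have hne : actions A V ≠ [] := List.ne_nil_of_mem hmem
      rw [hx, hq]
      simp [Phase.delay, hne]
  · right
    refine ⟨by rw [hx]; rfl, key (by rw [hx]; rfl) (by rw [hx]; simp [Phase.Inactive]),
      Or.inr ?_⟩
    have hV : actions A V = [] := by
      by_contra hne
      obtain ⟨b, l, hb⟩ := List.exists_cons_of_ne_nil hne
      obtain ⟨R, o, h, -⟩ := mem_actions.1 (hb ▸ List.mem_cons_self : b ∈ actions A V)
      exact hR ⟨R, o, h⟩
    rw [hx, hq]
    simp [Phase.delay, hV]
  · have := hF.phase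
    rw [hq] at this
    have hcase : d = none ∨ (d = a.2 ∧ (s r).color = a.1) := by
      rcases this with h | h | h
      · exact Or.inl h
      · cases h
      · exact Or.inr ⟨Phase.move.inj h.1, h.2⟩
    -- An empty movement is the end of an idle cycle and leads back to Look; any other pending
    -- movement is the one prescribed by `a`.
    by_cases hd : d = none
    · right
      subst hd
      refine ⟨by rw [hx]; rfl, key (by rw [hx]; rfl) (by rw [hx]; simp [Phase.Inactive]),
        Or.inr ?_⟩
      rw [hx, hq]
      simp [Phase.delay]
    · left
      obtain ⟨h1, h2⟩ := hcase.resolve_left hd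
      rw [hx]
      refine ⟨moveTo_token ?_, trivial⟩
      rw [h1, h2]
      exact ha

theorem AsyncExecution.transition {A : Algorithm Color} (E : AsyncExecution A k m n) (t : ℕ) :
    Transition A (E.state t) (E.state (t + 1)) := fun r => by
  by_cases h : r ∈ E.activated t
  · exact Or.inl (E.step_activated t r h)
  · exact Or.inr (E.step_other t r h)

/-- Each phase is followed by a different one. Thus an activated robot cannot keep its state, and
its `Phase.delay` must drop if it has not finished. -/
theorem RobotStep.ne {A : Algorithm Color} {s : SystemState Color k m n} {r : Fin k}
    {x : RobotState Color m n} (h : RobotStep A s r x) : x ≠ s r := by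
  rintro rfl
  rcases h with ⟨hq, hx⟩ | ⟨V, R, o, hq, hR, hx⟩ | ⟨V, hq, hR, hx⟩ | ⟨d, hq, hx⟩ <;>
  · have := congrArg RobotState.phase hx
    rw [hq] at this
    cases this

theorem SystemState.tokens_update {s s' : SystemState Color k m n} {r : Fin k} {T : Multiset Token}
    (h : ∀ q, q ≠ r → (s' q).token = (s q).token)
    (hT : SystemState.tokens s = (s r).token ::ₘ T) :
    SystemState.tokens s' = (s' r).token ::ₘ T := by
  have hsplit : ∀ u : SystemState Color k m n, SystemState.tokens u =
      (u r).token ::ₘ (Finset.univ.erase r).val.map fun q => (u q).token := by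
    intro u
    rw [SystemState.tokens, ← Multiset.map_cons (fun q => (u q).token), Finset.erase_val,
      Multiset.cons_erase (Finset.mem_univ_val r)]
  rw [hsplit] at hT ⊢
  rw [← (Multiset.cons_inj_right _).1 hT]
  congr 1
  exact Multiset.map_congr rfl fun q hq => h q (Finset.ne_of_mem_erase (show q ∈ Finset.univ.erase r from hq))

/-- Fairness gives a next activation of `r`, at which its delay drops or the action is completed.
The outer induction is on the delay, the inner one on the time left until that activation. -/
theorem AsyncExecution.exists_tracks_of_focus {A : Algorithm Color} (E : AsyncExecution A k m n)
    {r : Fin k} {a : Color × Option Dir} {p p' : Token} {T : Multiset Token}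
    (ha : actOn m n p a = some p') (t : ℕ) (hF : Focus A (E.state t) r a)
    (hp : (E.state t r).token = p) (hT : SystemState.tokens (E.state t) = p ::ₘ T) :
    ∃ t', t ≤ t' ∧ Tracks A (E.state t') (p' ::ₘ T) := by
  induction hd : (E.state t r).phase.delay A using Nat.strong_induction_on generalizing t with
  | _ d ih =>
    obtain ⟨t₁, ht₁, hact⟩ := E.fair r t
    obtain ⟨e, rfl⟩ := Nat.exists_eq_add_of_le ht₁
    induction e generalizing t with
    | zero =>
      obtain ⟨hO, h⟩ := hF.transition (hp.symm ▸ ha) (E.transition t)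
      have hT' := SystemState.tokens_update (fun q hq => (hO q hq).1) (hp.symm ▸ hT)
      rcases h with ⟨h1, h2⟩ | ⟨h1, h2, h3⟩
      · refine ⟨t + 1, Nat.le_succ t, by rw [hT', h1], fun q => ?_⟩
        by_cases hq : q = r
        · rw [hq]; exact h2
        · exact (hO q hq).2
      · have hlt := h3.resolve_left (E.step_activated t r hact).ne
        obtain ⟨t', ht', h⟩ := ih _ (hd ▸ hlt) (t + 1) h2 (h1.trans hp)
          (by rw [hT', h1, hp]) rfl
        exact ⟨t', by omega, h⟩
    | succ e ihe =>
      obtain ⟨hO, h⟩ := hF.transition (hp.symm ▸ ha) (E.transition t)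
      have hT' := SystemState.tokens_update (fun q hq => (hO q hq).1) (hp.symm ▸ hT)
      rcases h with ⟨h1, h2⟩ | ⟨h1, h2, h3⟩
      · refine ⟨t + 1, Nat.le_succ t, by rw [hT', h1], fun q => ?_⟩
        by_cases hq : q = r
        · rw [hq]; exact h2
        · exact (hO q hq).2
      · have hT'' : SystemState.tokens (E.state (t + 1)) = p ::ₘ T := by rw [hT', h1, hp]
        rcases h3 with h3 | h3
        · obtain ⟨t', ht', h⟩ := ihe (t + 1) h2 (h1.trans hp) hT'' (by rw [h3, hd])
            (by omega) (by rwa [show t + 1 + e = t + (e + 1) by omega])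
          exact ⟨t', by omega, h⟩
        · obtain ⟨t', ht', h⟩ := ih _ (hd ▸ h3) (t + 1) h2 (h1.trans hp) hT'' rfl
          exact ⟨t', by omega, h⟩

theorem AsyncExecution.exists_tracks_of_step {A : Algorithm Color} (E : AsyncExecution A k m n)
    {L L' : Multiset Token} (h : Step A m n L L') {t : ℕ} (ht : Tracks A (E.state t) L) :
    ∃ t', t ≤ t' ∧ Tracks A (E.state t') L' := by
  obtain ⟨p, p', T, a, rfl, rfl, ha, ⟨hne, hall⟩, hT⟩ := h
  obtain ⟨htok, hin⟩ := ht
  have hp : p ∈ SystemState.tokens (E.state t) := htok ▸ Multiset.mem_cons_self p T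
  obtain ⟨r, -, hr⟩ := Multiset.mem_map.1 hp
  refine E.exists_tracks_of_focus ha t (r := r) ⟨?_, ?_, fun q hq => ⟨?_, hin q⟩, Or.inl (hin r)⟩
    hr htok
  · rwa [SystemState.view_eq, htok, hr]
  · rwa [SystemState.view_eq, htok, hr]
  · rw [SystemState.view_eq, htok]
    apply hT
    have h1 : Finset.univ.val.map (fun q => (E.state t q).token) = p ::ₘ T := htok
    have h2 : (Finset.univ.erase r).val.map (fun q => (E.state t q).token) = T := by
      rw [← Multiset.cons_erase (Finset.mem_univ_val r), Multiset.map_cons, hr,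
        Multiset.cons_inj_right] at h1
      rw [Finset.erase_val, h1]
    rw [← h2]
    exact Multiset.mem_map_of_mem _ (Finset.mem_erase.2 ⟨hq, Finset.mem_univ q⟩)

/-- Reachability by steps. -/
abbrev Reach (A : Algorithm Color) (m n : ℕ) : Multiset Token → Multiset Token → Prop :=
  Relation.ReflTransGen (Step A m n)

theorem AsyncExecution.exists_tracks_of_reach {A : Algorithm Color} (E : AsyncExecution A k m n)
    {L L' : Multiset Token} (h : Reach A m n L L') {t : ℕ} (ht : Tracks A (E.state t) L) :
    ∃ t', t ≤ t' ∧ Tracks A (E.state t') L' := by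
  induction h with
  | refl => exact ⟨t, le_rfl, ht⟩
  | tail _ hs ih =>
    obtain ⟨t₁, h₁, ht₁⟩ := ih
    obtain ⟨t₂, h₂, ht₂⟩ := E.exists_tracks_of_step hs ht₁
    exact ⟨t₂, h₁.trans h₂, ht₂⟩

theorem Tracks.not_enabled {A : Algorithm Color} {s : SystemState Color k m n} {L : Multiset Token}
    (h : Tracks A s L) (hL : Idle A m n L L) (r : Fin k) : ¬ Enabled A s r := by
  rw [enabled_iff, not_not, SystemState.view_eq, h.1]
  refine hL _ ?_
  rw [← h.1]
  exact Multiset.mem_map_of_mem _ (Finset.mem_univ_val r)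

theorem Tracks.of_idle {A : Algorithm Color} {s s' : SystemState Color k m n}
    {L : Multiset Token} (h : Tracks A s L) (hL : Idle A m n L L) (hs : Transition A s s') :
    Tracks A s' L := by
  have key : ∀ q, (s' q).token = (s q).token ∧ (s' q).phase.Inactive A := by
    intro q
    rcases hs q with h' | h'
    · exact h'.of_not_enabled (not_not.1 fun hne => h.not_enabled hL q (enabled_iff.2 hne)) (h.2 q)
    · rw [h']; exact ⟨rfl, h.2 q⟩
  refine ⟨?_, fun q => (key q).2⟩
  rw [← h.1]
  simp only [SystemState.tokens, fun q => (key q).1]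

/-- If, following the steps, all nodes get occupied and a configuration without enabled robots is
reached, then every execution is a terminating exploration. -/
theorem solves_of_reach {A : Algorithm Color} {L : Multiset Token} {C : Configuration Color m n}
    (hC : ∀ s : SystemState Color k m n, SystemState.configuration s = C →
      SystemState.tokens s = L)
    (hvisit : ∀ x < m, ∀ y < n, ∃ L', Reach A m n L L' ∧ ∃ c, (x, y, c) ∈ L')
    (hfinal : ∃ L', Reach A m n L L' ∧ Idle A m n L' L') :
    SolvesTerminatingExploration A k C := by
  intro E hE
  have h0 : Tracks A (E.state 0) L := ⟨hC _ hE, fun r => by rw [E.start r]; trivial⟩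
  constructor
  · rintro ⟨x, y⟩
    obtain ⟨L', hL', c, hc⟩ := hvisit x x.isLt y y.isLt
    obtain ⟨t, -, ht⟩ := E.exists_tracks_of_reach hL' h0
    rw [← ht.1] at hc
    obtain ⟨r, -, hr⟩ := Multiset.mem_map.1 hc
    refine ⟨t, r, ?_⟩
    simp only [RobotState.token, Prod.mk.injEq] at hr
    exact Prod.ext (Fin.ext hr.1) (Fin.ext hr.2.1)
  · obtain ⟨L', hL', hI⟩ := hfinal
    obtain ⟨T, -, hT⟩ := E.exists_tracks_of_reach hL' h0
    refine ⟨T, fun t ht r => ?_⟩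
    have : Tracks A (E.state t) L' := by
      induction t, ht using Nat.le_induction with
      | base => exact hT
      | succ t _ ih => exact ih.of_idle hI (E.transition t)
    exact this.not_enabled hI r

end Tokens


/-! ### Patterns placed on the grid -/

def shift (i j : ℕ) (p : Token) : Token := (i + p.1, j + p.2.1, p.2.2)

/-- The tokens of `P` in a box with northwest corner at the coordinates `i`, `j`. -/
def place (i j : ℕ) (P : List Token) : Multiset Token := (P.map (shift i j) : List Token)

/-- The margins on the `m × n` grid of the box of `h` rows and `w` columns with northwest corner at
`i`, `j`. -/
def margins (m n i j h w : ℕ) : Margins :=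
  ⟨decide (0 < i), decide (j + w < n), decide (i + h < m), decide (0 < j)⟩

/-- The node of the token `q` is neither in the box nor adjacent to a node in the box. -/
def Apart (i j h w : ℕ) (q : Token) : Prop :=
  q.1 + 1 < i ∨ i + h < q.1 ∨ q.2.1 + 1 < j ∨ j + w < q.2.1 ∨
    ((q.1 < i ∨ i + h ≤ q.1) ∧ (q.2.1 < j ∨ j + w ≤ q.2.1))

theorem colorsIn_add (L Q : Multiset Token) (x y : ℕ) :
    colorsIn (L + Q) x y = colorsIn L x y + colorsIn Q x y := by
  simp [colorsIn, Multiset.filter_add]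

theorem colorsIn_eq_zero {L : Multiset Token} {x y : ℕ}
    (h : ∀ p ∈ L, ¬ (p.1 = x ∧ p.2.1 = y)) : colorsIn L x y = 0 := by
  rw [colorsIn, Multiset.filter_eq_nil.2 h, Multiset.map_zero]

theorem inBox_iff {h w : ℕ} {P : List Token} :
    inBox h w P = true ↔ ∀ p ∈ P, p.1 < h ∧ p.2.1 < w := by
  simp [inBox]

theorem mem_place {i j : ℕ} {P : List Token} {q : Token} :
    q ∈ place i j P ↔ ∃ p ∈ P, shift i j p = q := by
  simp [place]

theorem colorsIn_place (i j : ℕ) (P : List Token) (x y : ℕ) :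
    colorsIn (place i j P) (i + x) (j + y) = colorsAt P x y := by
  simp only [colorsIn, place, colorsAt, Multiset.filter_coe, Multiset.map_coe, List.filter_map,
    List.map_map]
  congr 2
  refine List.filter_congr fun p _ => ?_
  simp [shift]

/-- The robots of `Q` are on no node that a robot in the box can see, and those of `P` never leave
the box. A node just outside the box is therefore empty or missing, which is what the margins
record. Diagonal contact is allowed, as views do not include corners. -/
theorem boxView_eq {m n i j h w : ℕ} {P : List Token} {Q : Multiset Token} (hi : i + h ≤ m)
    (hj : j + w ≤ n) (hP : inBox h w P = true) (hQ : ∀ q ∈ Q, Apart i j h w q) {p : Token}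
    (hp : p ∈ P) :
    gridView m n (place i j P + Q) (shift i j p) = boxView h w (margins m n i j h w) P p := by
  obtain ⟨x, y, c⟩ := p
  obtain ⟨hx, hy⟩ := inBox_iff.1 hP _ hp
  simp only at hx hy
  have hz : ∀ X Y : ℕ, (X < i ∨ i + h ≤ X ∨ Y < j ∨ j + w ≤ Y) →
      colorsIn (place i j P) X Y = 0 := fun X Y hXY => colorsIn_eq_zero fun q hq => by
    obtain ⟨p, hp, rfl⟩ := mem_place.1 hq
    have := inBox_iff.1 hP p hp
    simp only [shift]
    omega
  have hq : ∀ X Y : ℕ, (i ≤ X ∧ X < i + h ∧ j ≤ Y + 1 ∧ Y ≤ j + w) ∨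
      (i ≤ X + 1 ∧ X ≤ i + h ∧ j ≤ Y ∧ Y < j + w) → colorsIn Q X Y = 0 := fun X Y hXY =>
    colorsIn_eq_zero fun q hq => by
      have := hQ q hq
      unfold Apart at this
      omega
  unfold gridView boxView
  congr 1
  · simp only [shift, colorsIn_add, colorsIn_place, hq (i + x) (j + y) (by omega), add_zero]
  · funext d
    cases d <;> simp only [shift, colorsIn_add, margins, decide_eq_true_eq]
    · rcases Nat.eq_zero_or_pos x with rfl | h1
      · by_cases h2 : 0 < i
        · simp [h2, hz (i - 1) (j + y) (by omega), hq (i - 1) (j + y) (by omega)]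
        · simp [h2]
      · have e : i + x - 1 = i + (x - 1) := by omega
        rw [if_pos (by omega), if_pos h1, e, colorsIn_place, hq _ _ (by omega), add_zero]
    · by_cases h1 : y + 1 < w
      · rw [if_pos (by omega), if_pos h1, hq _ _ (by omega), add_assoc, colorsIn_place, add_zero]
      · rw [if_neg h1]
        by_cases h2 : j + w < n
        · rw [if_pos (by omega), if_pos h2, hz _ _ (by omega), hq _ _ (by omega), add_zero]
        · rw [if_neg (by omega), if_neg h2]
    · by_cases h1 : x + 1 < h
      · rw [if_pos (by omega), if_pos h1, hq _ _ (by omega), add_assoc, colorsIn_place, add_zero]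
      · rw [if_neg h1]
        by_cases h2 : i + h < m
        · rw [if_pos (by omega), if_pos h2, hz _ _ (by omega), hq _ _ (by omega), add_zero]
        · rw [if_neg (by omega), if_neg h2]
    · rcases Nat.eq_zero_or_pos y with rfl | h1
      · by_cases h2 : 0 < j
        · simp [h2, hz (i + x) (j - 1) (by omega), hq (i + x) (j - 1) (by omega)]
        · simp [h2]
      · have e : j + y - 1 = j + (y - 1) := by omega
        rw [if_pos (by omega), if_pos h1, e, colorsIn_place, hq _ _ (by omega), add_zero]

/-- Being apart is symmetric: the outer robots do not see the box either. Their idleness is thus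
checked once, without the box, and survives whatever happens inside it. -/
theorem gridView_add_of_apart {m n i j h w : ℕ} {P : List Token} {Q : Multiset Token}
    (hP : inBox h w P = true) {q : Token} (hq : Apart i j h w q) :
    gridView m n (place i j P + Q) q = gridView m n Q q := by
  have hz : ∀ X Y : ℕ, (X < i ∨ i + h ≤ X ∨ Y < j ∨ j + w ≤ Y) →
      colorsIn (place i j P + Q) X Y = colorsIn Q X Y := fun X Y hXY => by
    rw [colorsIn_add, colorsIn_eq_zero, zero_add]
    intro p' hp'
    obtain ⟨p, hp, rfl⟩ := mem_place.1 hp'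
    have := inBox_iff.1 hP p hp
    simp only [shift]
    omega
  unfold Apart at hq
  unfold gridView
  congr 1
  · exact hz _ _ (by omega)
  · funext d
    cases d <;> simp only
    · by_cases h1 : 0 < q.1
      · rw [if_pos h1, if_pos h1, hz _ _ (by omega)]
      · rw [if_neg h1, if_neg h1]
    · rw [hz _ _ (by omega)]
    · rw [hz _ _ (by omega)]
    · by_cases h1 : 0 < q.2.1
      · rw [if_pos h1, if_pos h1, hz _ _ (by omega)]
      · rw [if_neg h1, if_neg h1]

theorem Idle.place_add {m n i j h w : ℕ} {P : List Token} {Q : Multiset Token}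
    {A : Algorithm Color} (hP : inBox h w P = true) (hQ : ∀ q ∈ Q, Apart i j h w q)
    (hI : Idle A m n Q Q) : Idle A m n (place i j P + Q) Q := fun q hq => by
  rw [gridView_add_of_apart hP (hQ q hq)]
  exact hI q hq

theorem idle_place_of_boxIdle {m n i j h w : ℕ} {P R : List Token} {Q : Multiset Token}
    (hi : i + h ≤ m) (hj : j + w ≤ n) (hP : inBox h w P = true)
    (hQ : ∀ q ∈ Q, Apart i j h w q) (hR : R ⊆ P)
    (hI : boxIdle h w (margins m n i j h w) P R = true) :
    Idle explorer m n (place i j P + Q) (place i j R) := fun q hq => by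
  obtain ⟨p, hp, rfl⟩ := mem_place.1 hq
  rw [boxView_eq hi hj hP hQ (hR hp)]
  simpa using List.all_eq_true.1 hI p hp

theorem idle_place_add {m n i j h w : ℕ} {P : List Token} {Q : Multiset Token}
    (hi : i + h ≤ m) (hj : j + w ≤ n) (hP : inBox h w P = true)
    (hQ : ∀ q ∈ Q, Apart i j h w q) (hI : boxIdle h w (margins m n i j h w) P P = true)
    (hQI : Idle explorer m n Q Q) : Idle explorer m n (place i j P + Q) (place i j P + Q) :=
  fun q hq => by
    rcases Multiset.mem_add.1 hq with h | h
    · exact idle_place_of_boxIdle hi hj hP hQ (List.Subset.refl P) hI q h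
    · exact Idle.place_add hP hQ hQI q h

theorem place_perm {i j : ℕ} {P P' : List Token} (h : P.Perm P') : place i j P = place i j P' :=
  Multiset.coe_eq_coe.2 (h.map _)

theorem place_cons (i j : ℕ) (p : Token) (P : List Token) :
    place i j (p :: P) = shift i j p ::ₘ place i j P := rfl

theorem actOn_shift {m n i j h w : ℕ} (hi : i + h ≤ m) (hj : j + w ≤ n) {p p' : Token}
    {a : Color × Option Dir} (ha : actOn h w p a = some p') :
    actOn m n (shift i j p) a = some (shift i j p') := by
  obtain ⟨x, y, b⟩ := p
  obtain ⟨c, d⟩ := a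
  rcases d with _ | d
  · simp only [actOn, Option.some.injEq] at ha ⊢
    subst ha
    rfl
  · obtain rfl := actOn_some_color ha
    cases d <;> simp only [actOn, shift, if_true] at ha ⊢ <;>
      rcases ite_eq_iff.1 ha with ⟨h1, h2⟩ | ⟨-, h2⟩ <;> cases h2
    · exact (if_pos (show 0 < i + x by omega)).trans (by simp only; rw [Nat.add_sub_assoc h1])
    · exact if_pos (show j + y + 1 < n by omega)
    · exact if_pos (show i + x + 1 < m by omega)
    · exact (if_pos (show 0 < j + y by omega)).trans (by simp only; rw [Nat.add_sub_assoc h1])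

/-! ### Transfer of box runs to the grid. -/

section Reach

variable {m n i j h w : ℕ} {Q : Multiset Token}

theorem step_of_boxNextAux (hi : i + h ≤ m) (hj : j + w ≤ n)
    (hQ : ∀ q ∈ Q, Apart i j h w q) (hI : Idle explorer m n Q Q) {P' : List Token} :
    ∀ S R : List Token, inBox h w (S ++ R) = true →
      boxNextAux h w (margins m n i j h w) S R = some P' →
      Step explorer m n (place i j (S ++ R) + Q) (place i j P' + Q)
  | _, [], _, hN => by simp [boxNextAux] at hN
  | S, p :: T, hB, hN => by
    have hperm : (p :: (S ++ T)).Perm (S ++ p :: T) := List.perm_middle.symm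
    have hB' : inBox h w (p :: (S ++ T)) = true :=
      inBox_iff.2 fun q hq => inBox_iff.1 hB q (hperm.mem_iff.1 hq)
    rw [← place_perm hperm]
    rw [boxNextAux] at hN
    split at hN
    · exact step_of_boxNextAux hi hj hQ hI (p :: S) T hB' hN
    · rename_i a l hact
      split_ifs at hN with hcond
      obtain ⟨p', hp', rfl⟩ := Option.map_eq_some_iff.1 hN
      rw [Bool.and_eq_true] at hcond
      obtain ⟨hall, hidle⟩ := hcond
      have hv := boxView_eq hi hj hB' hQ (List.mem_cons_self (a := p) (l := S ++ T))
      refine ⟨shift i j p, shift i j p', place i j (S ++ T) + Q, a, ?_, ?_,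
        actOn_shift hi hj hp', ⟨?_, ?_⟩, ?_⟩
      · rw [place_cons, Multiset.cons_add]
      · rw [place_cons, Multiset.cons_add]
      · rw [hv, hact]
        exact List.cons_ne_nil a l
      · rw [hv, hact]
        intro b hb
        rcases List.mem_cons.1 hb with h | h
        · exact h
        · simpa using List.all_eq_true.1 hall b h
      · intro q hq
        rcases Multiset.mem_add.1 hq with h | h
        · exact idle_place_of_boxIdle hi hj hB' hQ (List.subset_cons_self p _) hidle q h
        · exact Idle.place_add hB' hQ hI q h

theorem reach_of_boxRun (hi : i + h ≤ m) (hj : j + w ≤ n)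
    (hQ : ∀ q ∈ Q, Apart i j h w q) (hI : Idle explorer m n Q Q) {R : List Token} :
    ∀ (k : ℕ) (P : List Token), boxRun h w (margins m n i j h w) k P = some R →
      Reach explorer m n (place i j P + Q) (place i j R + Q)
  | 0, P, hR => by
    cases hR
    exact Relation.ReflTransGen.refl
  | k + 1, P, hR => by
    obtain ⟨P₁, h1, h2⟩ := Option.bind_eq_some_iff.1 hR
    refine Relation.ReflTransGen.head ?_ (reach_of_boxRun hi hj hQ hI k P₁ h2)
    rw [boxNext] at h1
    split_ifs at h1 with hB
    exact step_of_boxNextAux hi hj hQ hI [] P hB h1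

theorem reach_of_boxReaches (k : ℕ) {P P' : List Token}
    (hR : boxReaches h w (margins m n i j h w) k P P' = true) (hi : i + h ≤ m) (hj : j + w ≤ n)
    (hQ : ∀ q ∈ Q, Apart i j h w q) (hI : Idle explorer m n Q Q) :
    Reach explorer m n (place i j P + Q) (place i j P' + Q) := by
  rw [boxReaches] at hR
  split at hR
  · rename_i R hrun
    rw [← place_perm (List.isPerm_iff.1 hR)]
    exact reach_of_boxRun hi hj hQ hI k P hrun
  · cases hR

end Reach


/-! ### Exploring a row -/

open Color

/-- The shuttle heading east. -/
def eastward : List Token := [(0, 0, G), (0, 1, W), (0, 1, B)]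

/-- The shuttle heading west. -/
def westward : List Token := [(0, 0, W), (0, 0, B), (0, 1, G)]

theorem Apart.mono {i j h w i' j' h' w' : ℕ} {q : Token} (hq : Apart i j h w q) (hi : i ≤ i')
    (hh : i' + h' ≤ i + h) (hj : j ≤ j') (hw : j' + w' ≤ j + w) : Apart i' j' h' w' q := by
  unfold Apart at hq ⊢
  omega

/-- `B` goes ahead, `G` joins `W`, then `W` joins `B`. All margins are admitted, so the same check
serves in every row and column. -/
theorem boxReaches_eastward : ∀ a b c d : Bool,
    boxReaches 1 3 ⟨a, b, c, d⟩ 3 eastward [(0, 1, G), (0, 2, W), (0, 2, B)] = true := by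
  decide +kernel

/-- `B` notices the border and becomes `G`, the rear `G` becomes `B`, and `W` changes sides: the
result is the mirrored shuttle. -/
theorem boxReaches_turn : ∀ a c d : Bool,
    boxReaches 1 2 ⟨a, false, c, d⟩ 3 eastward westward = true := by
  decide +kernel

theorem boxReaches_westward : ∀ a b c d : Bool,
    boxReaches 1 3 ⟨a, b, c, d⟩ 3 [(0, 1, W), (0, 1, B), (0, 2, G)] westward = true := by
  decide +kernel

section Row

variable {m n i j : ℕ} {Q : Multiset Token}

/-- The bystanders are apart from the whole strip from column `j` to the east border, hence by
`Apart.mono` from each box that the shuttle uses. -/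
theorem reach_eastward (hi : i < m) (hQ : ∀ q ∈ Q, Apart i j 1 (n - j) q)
    (hI : Idle explorer m n Q Q) {l : ℕ} (hl : j ≤ l) (hn : l + 2 ≤ n) :
    Reach explorer m n (place i j eastward + Q) (place i l eastward + Q) := by
  induction l, hl using Nat.le_induction with
  | base => exact Relation.ReflTransGen.refl
  | succ l hl ih =>
    refine (ih (by omega)).trans ?_
    exact reach_of_boxReaches (i := i) (j := l) 3 (boxReaches_eastward _ _ _ _) (by omega)
      (by omega) (fun q hq => (hQ q hq).mono le_rfl le_rfl hl (by omega)) hI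

theorem reach_turn (hi : i < m) (hQ : ∀ q ∈ Q, Apart i j 1 (n - j) q)
    (hI : Idle explorer m n Q Q) (hn : j + 2 ≤ n) :
    Reach explorer m n (place i (n - 2) eastward + Q) (place i (n - 2) westward + Q) := by
  have hM : margins m n i (n - 2) 1 2 =
      ⟨decide (0 < i), false, decide (i + 1 < m), decide (0 < n - 2)⟩ := by
    simp only [margins, Margins.mk.injEq, true_and, and_true, decide_eq_false_iff_not]
    omega
  exact reach_of_boxReaches 3 (hM ▸ boxReaches_turn _ _ _) (by omega) (by omega)
    (fun q hq => (hQ q hq).mono le_rfl le_rfl (by omega) (by omega)) hI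

theorem reach_westward (hi : i < m) (hQ : ∀ q ∈ Q, Apart i j 1 (n - j) q)
    (hI : Idle explorer m n Q Q) {l : ℕ} (hl : j ≤ l) (hn : l + 2 ≤ n) :
    Reach explorer m n (place i l westward + Q) (place i j westward + Q) := by
  induction l, hl using Nat.le_induction with
  | base => exact Relation.ReflTransGen.refl
  | succ l hl ih =>
    refine Relation.ReflTransGen.trans ?_ (ih (by omega))
    exact reach_of_boxReaches (i := i) (j := l) 3 (boxReaches_westward _ _ _ _) (by omega)
      (by omega) (fun q hq => (hQ q hq).mono le_rfl le_rfl hl (by omega)) hI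

theorem reach_row (hi : i < m) (hQ : ∀ q ∈ Q, Apart i j 1 (n - j) q)
    (hI : Idle explorer m n Q Q) (hn : j + 2 ≤ n) :
    Reach explorer m n (place i j eastward + Q) (place i j westward + Q) :=
  (reach_eastward hi hQ hI (l := n - 2) (by omega) (by omega)).trans
    ((reach_turn hi hQ hI hn).trans (reach_westward hi hQ hI (by omega) (by omega)))

theorem visit_row (hi : i < m) (hQ : ∀ q ∈ Q, Apart i j 1 (n - j) q)
    (hI : Idle explorer m n Q Q) (hn : j + 2 ≤ n) {y : ℕ} (hy : j ≤ y) (hyn : y < n) :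
    ∃ L, Reach explorer m n (place i j eastward + Q) L ∧ ∃ c, (i, y, c) ∈ L := by
  by_cases h : y + 2 ≤ n
  · refine ⟨_, reach_eastward hi hQ hI hy h, G, ?_⟩
    exact Multiset.mem_add.2 (Or.inl (mem_place.2 ⟨(0, 0, G), by simp [eastward], rfl⟩))
  -- The rear `G` stops in column `n - 2`; only the front of the shuttle touches the last column.
  · refine ⟨_, reach_eastward hi hQ hI (l := n - 2) (by omega) (by omega), W, ?_⟩
    refine Multiset.mem_add.2 (Or.inl (mem_place.2 ⟨(0, 1, W), by simp [eastward], ?_⟩))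
    simp only [shift, Prod.mk.injEq, and_true]
    omega

end Row

/-! ### The first two rows -/

def initialPattern : List Token :=
  [(0, 0, G), (0, 1, W), (0, 2, W), (1, 0, W), (1, 0, B), (1, 1, W)]

/-- The configuration when the first two rows are explored. -/
def secondRowExplored : List Token :=
  [(0, 0, W), (0, 1, B), (0, 1, B), (1, 0, W), (1, 0, B), (1, 1, G)]

/-- The robots waiting at the northwest corner while the first row is explored. -/
def firstWaiting : List Token := [(0, 0, B), (1, 0, G), (1, 0, B)]

/-- The robots waiting at the northwest corner while the second row is explored. -/
def secondWaiting : List Token := [(0, 0, W), (0, 1, B), (0, 1, B)]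

theorem place_append (i j : ℕ) (P R : List Token) :
    place i j (P ++ R) = place i j P + place i j R := by
  simp [place, Multiset.coe_add]

theorem idle_place {m n i j h w : ℕ} {P : List Token} (hi : i + h ≤ m) (hj : j + w ≤ n)
    (hP : inBox h w P = true) (hI : boxIdle h w (margins m n i j h w) P P = true) :
    Idle explorer m n (place i j P) (place i j P) := by
  have := idle_place_add (Q := 0) hi hj hP (by simp) hI (fun q hq => by simp at hq)
  rwa [add_zero] at this

theorem reach_place {m n i j h w : ℕ} (k : ℕ) {P P' : List Token}
    (hR : boxReaches h w (margins m n i j h w) k P P' = true) (hi : i + h ≤ m) (hj : j + w ≤ n) :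
    Reach explorer m n (place i j P) (place i j P') := by
  have := reach_of_boxReaches (Q := 0) k hR hi hj (by simp) (fun q hq => by simp at hq)
  rwa [add_zero, add_zero] at this

theorem margins_corner {m n h w : ℕ} :
    margins m n 0 0 h w = ⟨false, decide (w < n), decide (h < m), false⟩ := by
  simp [margins]

/-- With three columns there is no room for a shuttle in columns 2 and 3, so the first two rows are
run entirely inside one box. The run is cut when `B` stands on the last node of the second row,
which proves that this node is visited. -/
theorem boxReaches_narrow_first : boxReaches 2 3 ⟨false, false, true, false⟩ 18 initialPattern
    (secondWaiting ++ [(1, 0, G), (1, 1, W), (1, 2, B)]) = true := by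
  decide +kernel

theorem boxReaches_narrow_second : boxReaches 2 3 ⟨false, false, true, false⟩ 8
    (secondWaiting ++ [(1, 0, G), (1, 1, W), (1, 2, B)]) secondRowExplored = true := by
  decide +kernel

theorem boxReaches_wide_first : ∀ e, boxReaches 2 4 ⟨false, e, true, false⟩ 9 initialPattern
    ([(0, 2, G), (0, 3, W), (0, 3, B)] ++ firstWaiting) = true := by
  decide +kernel

theorem boxReaches_wide_second : ∀ e, boxReaches 2 4 ⟨false, e, true, false⟩ 17
    ([(0, 2, W), (0, 2, B), (0, 3, G)] ++ firstWaiting)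
    ([(1, 2, G), (1, 3, W), (1, 3, B)] ++ secondWaiting) = true := by
  decide +kernel

theorem boxReaches_wide_third : ∀ e, boxReaches 2 4 ⟨false, e, true, false⟩ 6
    ([(1, 2, W), (1, 2, B), (1, 3, G)] ++ secondWaiting) secondRowExplored = true := by
  decide +kernel

theorem boxIdle_firstWaiting :
    boxIdle 2 1 ⟨false, true, true, false⟩ firstWaiting firstWaiting = true := by
  decide +kernel

theorem boxIdle_secondWaiting :
    boxIdle 1 2 ⟨false, true, true, false⟩ secondWaiting secondWaiting = true := by
  decide +kernel

/-! ### The first two rows on grids of arbitrary size. -/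

section FirstRows

variable {m n : ℕ}

theorem idle_firstWaiting (hm : 3 ≤ m) (hn : 3 ≤ n) :
    Idle explorer m n (place 0 0 firstWaiting) (place 0 0 firstWaiting) := by
  refine idle_place (h := 2) (w := 1) (by omega) (by omega) (by decide) ?_
  rw [margins_corner, decide_eq_true (show 1 < n by omega), decide_eq_true (show 2 < m by omega)]
  exact boxIdle_firstWaiting

theorem idle_secondWaiting (hm : 3 ≤ m) (hn : 3 ≤ n) :
    Idle explorer m n (place 0 0 secondWaiting) (place 0 0 secondWaiting) := by
  refine idle_place (h := 1) (w := 2) (by omega) (by omega) (by decide) ?_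
  rw [margins_corner, decide_eq_true (show 2 < n by omega), decide_eq_true (show 1 < m by omega)]
  exact boxIdle_secondWaiting

theorem apart_firstWaiting :
    ∀ q ∈ place 0 0 firstWaiting, Apart 0 2 1 (n - 2) q := by
  simp [place, firstWaiting, shift, Apart]

theorem apart_secondWaiting :
    ∀ q ∈ place 0 0 secondWaiting, Apart 1 2 1 (n - 2) q := by
  simp [place, secondWaiting, shift, Apart]

theorem reach_firstRow (hm : 3 ≤ m) (hn : 4 ≤ n) : Reach explorer m n (place 0 0 initialPattern)
    (place 0 2 eastward + place 0 0 firstWaiting) := by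
  have := reach_place (m := m) (n := n) (i := 0) (j := 0) (h := 2) (w := 4) 9
    (by rw [margins_corner, decide_eq_true (show 2 < m by omega)]; exact boxReaches_wide_first _)
    (by omega) (by omega)
  rwa [place_append] at this

theorem reach_secondRow (hm : 3 ≤ m) (hn : 4 ≤ n) : Reach explorer m n (place 0 0 initialPattern)
    (place 1 2 eastward + place 0 0 secondWaiting) := by
  refine (reach_firstRow hm hn).trans ((reach_row (by omega) apart_firstWaiting
    (idle_firstWaiting hm (by omega)) (by omega)).trans ?_)
  have := reach_place (m := m) (n := n) (i := 0) (j := 0) (h := 2) (w := 4) 17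
    (by rw [margins_corner, decide_eq_true (show 2 < m by omega)]; exact boxReaches_wide_second _)
    (by omega) (by omega)
  rwa [place_append, place_append] at this

theorem reach_secondRow_narrow (hm : 3 ≤ m) : Reach explorer m 3 (place 0 0 initialPattern)
    (place 0 0 (secondWaiting ++ [(1, 0, G), (1, 1, W), (1, 2, B)])) :=
  reach_place (h := 2) (w := 3) 18
    (by rw [margins_corner, decide_eq_true (show 2 < m by omega)]; exact boxReaches_narrow_first)
    (by omega) (by omega)

theorem reach_secondRowExplored (hm : 3 ≤ m) (hn : 3 ≤ n) :
    Reach explorer m n (place 0 0 initialPattern) (place 0 0 secondRowExplored) := by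
  rcases hn.eq_or_lt with rfl | hn'
  · refine (reach_secondRow_narrow hm).trans (reach_place (h := 2) (w := 3) 8 ?_ (by omega)
      (by omega))
    rw [margins_corner, decide_eq_true (show 2 < m by omega)]
    exact boxReaches_narrow_second
  · refine (reach_secondRow hm hn').trans ((reach_row (by omega) apart_secondWaiting
      (idle_secondWaiting hm hn) (by omega)).trans ?_)
    have := reach_place (m := m) (n := n) (i := 0) (j := 0) (h := 2) (w := 4) 6
      (by rw [margins_corner, decide_eq_true (show 2 < m by omega)]; exact boxReaches_wide_third _)
      (by omega) (by omega)
    rwa [place_append] at this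

theorem visit_initial {x y : ℕ} {c : Color} (h : (x, y, c) ∈ initialPattern) :
    ∃ L, Reach explorer m n (place 0 0 initialPattern) L ∧ ∃ c, (x, y, c) ∈ L :=
  ⟨_, Relation.ReflTransGen.refl, c, mem_place.2 ⟨_, h, by simp [shift]⟩⟩

theorem visit_firstRow (hm : 3 ≤ m) (hn : 3 ≤ n) {y : ℕ} (hy : y < n) :
    ∃ L, Reach explorer m n (place 0 0 initialPattern) L ∧ ∃ c, (0, y, c) ∈ L := by
  by_cases h : y < 3
  · interval_cases y
    · exact visit_initial (c := G) (by simp [initialPattern])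
    · exact visit_initial (c := W) (by simp [initialPattern])
    · exact visit_initial (c := W) (by simp [initialPattern])
  · obtain ⟨L, hL, hc⟩ := visit_row (m := m) (n := n) (i := 0) (by omega) apart_firstWaiting
      (idle_firstWaiting hm hn) (by omega) (show 2 ≤ y by omega) hy
    exact ⟨L, (reach_firstRow hm (by omega)).trans hL, hc⟩

theorem visit_secondRow (hm : 3 ≤ m) (hn : 3 ≤ n) {y : ℕ} (hy : y < n) :
    ∃ L, Reach explorer m n (place 0 0 initialPattern) L ∧ ∃ c, (1, y, c) ∈ L := by
  by_cases h : y < 2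
  · interval_cases y
    · exact visit_initial (c := W) (by simp [initialPattern])
    · exact visit_initial (c := W) (by simp [initialPattern])
  rcases hn.eq_or_lt with rfl | hn'
  · obtain rfl : y = 2 := by omega
    exact ⟨_, reach_secondRow_narrow hm, B, mem_place.2 ⟨(1, 2, B), by simp, rfl⟩⟩
  · obtain ⟨L, hL, hc⟩ := visit_row (m := m) (n := n) (i := 1) (by omega) apart_secondWaiting
      (idle_secondWaiting hm hn) (by omega) (show 2 ≤ y by omega) hy
    exact ⟨L, (reach_secondRow hm hn').trans hL, hc⟩

end FirstRows

/-! ### The other rows -/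

/-- The two robots that stay on the second node of the northmost row. -/
def parked : Multiset Token := place 0 1 [(0, 0, B), (0, 0, B)]

def down (P : List Token) : List Token := P.map (shift 1 0)

/-- The shuttle is about to explore the row below the marker of color `c`. -/
def departure (c : Color) : List Token := [(0, 0, c), (1, 1, G), (1, 2, W), (1, 2, B)]

/-- The shuttle has come back near the marker of color `c`. -/
def arrival (c : Color) : List Token := [(0, 0, c), (1, 1, W), (1, 1, B), (1, 2, G)]

/-- The row below the marker of color `c` is explored. -/
def explored (c : Color) : List Token := [(0, 0, c), (1, 0, W), (1, 0, B), (1, 1, G)]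

/-- The color of the marker while the row below it is explored; `b` tells whether there is a further
row. -/
def markerColor (b : Bool) : Color := if b then W else G

theorem place_down (i j : ℕ) (P : List Token) : place i j (down P) = place (i + 1) j P := by
  simp only [place, down, List.map_map]
  congr 2
  funext p
  simp [shift, Nat.add_assoc]

theorem boxReaches_arrival : ∀ b e s : Bool, boxReaches 2 3 ⟨true, e, s, false⟩ 3
    (arrival (markerColor b)) (explored (markerColor b)) = true := by
  decide +kernel

/-- With the marker in row 1, the parked pair is adjacent to the box, so it is included in a box
with one more row; the other `_below` lemmas serve the same purpose. -/
theorem boxReaches_arrival_below : ∀ b e s : Bool, boxReaches 3 3 ⟨false, e, s, false⟩ 3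
    ([(0, 1, B), (0, 1, B)] ++ down (arrival (markerColor b)))
    ([(0, 1, B), (0, 1, B)] ++ down (explored (markerColor b))) = true := by
  decide +kernel

theorem boxReaches_next : ∀ e, boxReaches 3 3 ⟨true, e, true, false⟩ 12 (explored W)
    (down (departure W)) = true := by
  decide +kernel

theorem boxReaches_next_below : ∀ e, boxReaches 4 3 ⟨false, e, true, false⟩ 12
    ([(0, 1, B), (0, 1, B)] ++ down (explored W))
    ([(0, 1, B), (0, 1, B)] ++ down (down (departure W))) = true := by
  decide +kernel

/-- Here the marker itself is next to the parked pair, so the pair is part of the pattern from the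
start. -/
theorem boxReaches_next_second : ∀ e, boxReaches 3 3 ⟨false, e, true, false⟩ 12 secondRowExplored
    ([(0, 1, B), (0, 1, B)] ++ down (departure W)) = true := by
  decide +kernel

/-- The south border is noticed once `W` and `B` share the corner of the new row. Other rules then
take over, need two more steps, and leave a marker of color `G`. -/
theorem boxReaches_last : ∀ e, boxReaches 3 3 ⟨true, e, false, false⟩ 14 (explored W)
    (down (departure G)) = true := by
  decide +kernel

theorem boxReaches_last_below : ∀ e, boxReaches 4 3 ⟨false, e, false, false⟩ 14
    ([(0, 1, B), (0, 1, B)] ++ down (explored W))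
    ([(0, 1, B), (0, 1, B)] ++ down (down (departure G))) = true := by
  decide +kernel

theorem boxReaches_last_second : ∀ e, boxReaches 3 3 ⟨false, e, false, false⟩ 14 secondRowExplored
    ([(0, 1, B), (0, 1, B)] ++ down (departure G)) = true := by
  decide +kernel

theorem boxIdle_explored : ∀ e, boxIdle 2 3 ⟨true, e, false, false⟩ (explored G)
    (explored G) = true := by
  decide +kernel

theorem boxIdle_explored_below : ∀ e, boxIdle 3 3 ⟨false, e, false, false⟩
    ([(0, 1, B), (0, 1, B)] ++ down (explored G))
    ([(0, 1, B), (0, 1, B)] ++ down (explored G)) = true := by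
  decide +kernel

theorem boxIdle_parked : boxIdle 1 1 ⟨false, true, true, true⟩ [(0, 0, B), (0, 0, B)]
    [(0, 0, B), (0, 0, B)] = true := by
  decide +kernel

theorem boxIdle_marker : ∀ b, boxIdle 1 1 ⟨true, true, true, false⟩ [(0, 0, markerColor b)]
    [(0, 0, markerColor b)] = true := by
  decide +kernel

/-! ### Induction over the remaining rows. -/

section Rows

variable {m n i : ℕ}

theorem apart_parked_of_lt {h : ℕ} (hi : 1 < i) : ∀ q ∈ parked, Apart i 0 h 3 q := by
  intro q hq
  have : q = (0, 1, B) := by simpa [parked, place, shift] using hq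
  subst this
  unfold Apart
  omega

theorem idle_parked (hm : 3 ≤ m) (hn : 3 ≤ n) : Idle explorer m n parked parked := by
  refine idle_place (h := 1) (w := 1) (by omega) (by omega) (by decide) ?_
  have hM : margins m n 0 1 1 1 = ⟨false, true, true, true⟩ := by
    rw [margins, decide_eq_true (show 1 + 1 < n by omega), decide_eq_true (show 0 + 1 < m by omega)]
    rfl
  rw [hM]
  exact boxIdle_parked

theorem place_add_parked (P : List Token) :
    place 1 0 P + parked = place 0 0 ([(0, 1, B), (0, 1, B)] ++ down P) := by
  rw [place_append, place_down, add_comm]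
  rfl

theorem margins_west {h : ℕ} (hi : 0 < i) :
    margins m n i 0 h 3 = ⟨true, decide (3 < n), decide (i + h < m), false⟩ := by
  simp [margins, hi]

/-- A run near the marker in row `i`. -/
theorem reach_add_parked {h : ℕ} (k : ℕ) {s : Bool} {P P' : List Token} (hi : 1 ≤ i)
    (him : i + h ≤ m) (hm : 3 ≤ m) (hn : 3 ≤ n) (hs : decide (i + h < m) = s)
    (h1 : ∀ e, boxReaches h 3 ⟨true, e, s, false⟩ k P P' = true)
    (h2 : ∀ e, boxReaches (h + 1) 3 ⟨false, e, s, false⟩ k ([(0, 1, B), (0, 1, B)] ++ down P)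
      ([(0, 1, B), (0, 1, B)] ++ down P') = true) :
    Reach explorer m n (place i 0 P + parked) (place i 0 P' + parked) := by
  -- For `i = 1` the parked pair is put inside a taller box starting in row 0; for larger `i` it is
  -- apart from the box and remains a bystander.
  rcases hi.eq_or_lt with rfl | hi'
  · rw [place_add_parked, place_add_parked]
    refine reach_place (h := h + 1) (w := 3) k ?_ (by omega) (by omega)
    rw [margins_corner, add_comm h 1, hs, add_comm 1 h]
    exact h2 _
  · refine reach_of_boxReaches (h := h) (w := 3) k ?_ him (by omega) (apart_parked_of_lt hi')
      (idle_parked hm hn)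
    rw [margins_west (by omega), hs]
    exact h1 _

/-- The marker and the parked pair are regrouped as the bystanders of a run of the shuttle along row
`i + 1`. -/
theorem departure_eq (c : Color) : place i 0 (departure c) + parked =
    place (i + 1) 1 eastward + (place i 0 [(0, 0, c)] + parked) := by
  rw [show departure c = [(0, 0, c)] ++ [(1, 1, G), (1, 2, W), (1, 2, B)] from rfl, place_append,
    add_comm (place i 0 [(0, 0, c)]), add_assoc]
  rfl

theorem arrival_eq (c : Color) : place i 0 (arrival c) + parked =
    place (i + 1) 1 westward + (place i 0 [(0, 0, c)] + parked) := by
  rw [show arrival c = [(0, 0, c)] ++ [(1, 1, W), (1, 1, B), (1, 2, G)] from rfl, place_append,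
    add_comm (place i 0 [(0, 0, c)]), add_assoc]
  rfl

theorem idle_marker (hi : 1 ≤ i) (him : i + 1 < m) (hm : 3 ≤ m) (hn : 3 ≤ n) (b : Bool) :
    Idle explorer m n (place i 0 [(0, 0, markerColor b)] + parked)
      (place i 0 [(0, 0, markerColor b)] + parked) := by
  refine idle_place_add (h := 1) (w := 1) (by omega) (by omega) rfl ?_ ?_ (idle_parked hm hn)
  · intro q hq
    have : q = (0, 1, B) := by simpa [parked, place, shift] using hq
    subst this
    simp only [Apart]
    omega
  · have hM : margins m n i 0 1 1 = ⟨true, true, true, false⟩ := by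
      simp only [margins, Margins.mk.injEq, decide_eq_true_eq, decide_eq_false_iff_not]
      omega
    rw [hM]
    exact boxIdle_marker b

/-- The marker touches the strip only diagonally. This is why the run along the row starts in column
1 and not in column 0. -/
theorem apart_marker (hi : 1 ≤ i) (c : Color) :
    ∀ q ∈ place i 0 [(0, 0, c)] + parked, Apart (i + 1) 1 1 (n - 1) q := by
  intro q hq
  have : q = (i, 0, c) ∨ q = (0, 1, B) := by simpa [parked, place, shift] using hq
  unfold Apart
  rcases this with rfl | rfl <;> simp only <;> omega

theorem reach_explored (hi : 1 ≤ i) (him : i + 1 < m) (hn : 3 ≤ n) (b : Bool) :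
    Reach explorer m n (place i 0 (departure (markerColor b)) + parked)
      (place i 0 (explored (markerColor b)) + parked) := by
  refine Relation.ReflTransGen.trans (b := place i 0 (arrival (markerColor b)) + parked) ?_ ?_
  · rw [departure_eq, arrival_eq]
    exact reach_row him (apart_marker hi _) (idle_marker hi him (by omega) hn b) (by omega)
  · exact reach_add_parked 3 hi (by omega) (by omega) hn rfl (fun e => boxReaches_arrival b e _)
      (fun e => boxReaches_arrival_below b e _)

theorem reach_next (hi : 1 ≤ i) (him : i + 2 < m) (hn : 3 ≤ n) :
    Reach explorer m n (place i 0 (explored W) + parked)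
      (place (i + 1) 0 (departure (markerColor (decide (i + 3 < m)))) + parked) := by
  rw [← place_down]
  by_cases h : i + 3 < m
  · rw [decide_eq_true h]
    exact reach_add_parked 12 hi him (by omega) hn (decide_eq_true h) boxReaches_next
      boxReaches_next_below
  · rw [decide_eq_false h]
    exact reach_add_parked 14 hi him (by omega) hn (decide_eq_false h) boxReaches_last
      boxReaches_last_below

theorem reach_next_second (hm : 3 ≤ m) (hn : 3 ≤ n) :
    Reach explorer m n (place 0 0 secondRowExplored)
      (place 1 0 (departure (markerColor (decide (3 < m)))) + parked) := by
  rw [place_add_parked]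
  by_cases h : 3 < m
  · rw [decide_eq_true h]
    refine reach_place (h := 3) (w := 3) 12 ?_ (by omega) (by omega)
    rw [margins_corner, decide_eq_true h]
    exact boxReaches_next_second _
  · rw [decide_eq_false h]
    refine reach_place (h := 3) (w := 3) 14 ?_ (by omega) (by omega)
    rw [margins_corner, decide_eq_false h]
    exact boxReaches_last_second _

theorem reach_departure (hm : 3 ≤ m) (hn : 3 ≤ n) (hi : 1 ≤ i) (him : i + 1 < m) :
    Reach explorer m n (place 0 0 initialPattern)
      (place i 0 (departure (markerColor (decide (i + 2 < m)))) + parked) := by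
  induction i, hi using Nat.le_induction with
  | base => exact (reach_secondRowExplored hm hn).trans (reach_next_second hm hn)
  | succ i hi ih =>
    have := reach_explored hi (show i + 1 < m by omega) hn (decide (i + 2 < m))
    refine (ih (by omega)).trans (this.trans ?_)
    -- Row `i + 2` exists, so the marker used for row `i + 1` is `W`, as `reach_next` requires.
    rw [decide_eq_true him]
    exact reach_next hi him hn

theorem visit (hm : 3 ≤ m) (hn : 3 ≤ n) {x y : ℕ} (hx : x < m) (hy : y < n) :
    ∃ L, Reach explorer m n (place 0 0 initialPattern) L ∧ ∃ c, (x, y, c) ∈ L := by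
  rcases x with _ | _ | x
  · exact visit_firstRow hm hn hy
  · exact visit_secondRow hm hn hy
  have hd := reach_departure hm hn (show 1 ≤ x + 1 by omega) hx
  -- The strip explored by the shuttle omits column 0; that node is occupied when the shuttle is
  -- back at the west border.
  rcases Nat.eq_zero_or_pos y with rfl | hy0
  · refine ⟨_, hd.trans (reach_explored (by omega) hx hn _), W, ?_⟩
    exact Multiset.mem_add.2 (Or.inl (mem_place.2 ⟨(1, 0, W), by simp [explored], rfl⟩))
  · rw [departure_eq] at hd
    obtain ⟨L, hL, hc⟩ := visit_row hx (apart_marker (by omega) _)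
      (idle_marker (by omega) hx hm hn _) (by omega) hy0 hy
    exact ⟨L, hd.trans hL, hc⟩

theorem exists_reach_idle (hm : 3 ≤ m) (hn : 3 ≤ n) :
    ∃ L, Reach explorer m n (place 0 0 initialPattern) L ∧ Idle explorer m n L L := by
  obtain ⟨i, rfl⟩ : ∃ i, m = i + 2 := ⟨m - 2, by omega⟩
  have hd := (reach_departure hm hn (show 1 ≤ i by omega) (by omega)).trans
    (reach_explored (show 1 ≤ i by omega) (by omega) hn _)
  -- Row `i + 1` is the southmost one, so the marker is `G`.
  rw [decide_eq_false (lt_irrefl (i + 2))] at hd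
  refine ⟨_, hd, ?_⟩
  rcases (show 1 ≤ i by omega).eq_or_lt with rfl | hi
  · rw [place_add_parked]
    refine idle_place (h := 3) (w := 3) (by omega) (by omega) (by decide) ?_
    rw [margins_corner]
    exact boxIdle_explored_below _
  · refine idle_place_add (h := 2) (w := 3) (by omega) (by omega) (by decide) ?_ ?_
      (idle_parked hm hn)
    · exact apart_parked_of_lt hi
    · rw [margins_west (by omega), decide_eq_false (lt_irrefl (i + 2))]
      exact boxIdle_explored _

end Rows

/-! ### The initial configuration -/

/-- The multiplicity of a token is that of its color on its node. So the initial configuration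
determines the multiset of tokens, whatever the numbering of the robots. -/
theorem eq_of_colorsIn_eq {L L' : Multiset Token} (h : ∀ x y, colorsIn L x y = colorsIn L' x y) :
    L = L' := by
  have key : ∀ (L : Multiset Token) (x y : ℕ) (c : Color),
      Multiset.count (x, y, c) L = Multiset.count c (colorsIn L x y) := by
    intro L x y c
    rw [colorsIn, Multiset.count_map, Multiset.filter_filter, Multiset.count_eq_card_filter_eq]
    congr 1
    refine Multiset.filter_congr fun p _ => ?_
    obtain ⟨a, b, d⟩ := p
    simp only [Prod.mk.injEq]
    constructor
    · rintro ⟨rfl, rfl, rfl⟩; simp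
    · rintro ⟨rfl, rfl, rfl⟩; simp
  ext ⟨x, y, c⟩
  rw [key, key, h]

theorem colorsIn_initialPattern {m n : ℕ} (v : Node m n) :
    colorsIn (place 0 0 initialPattern) v.1.val v.2.val = initialConfiguration m n v := by
  obtain ⟨⟨x, hx⟩, ⟨y, hy⟩⟩ := v
  have h := colorsIn_place 0 0 initialPattern x y
  rw [zero_add, zero_add] at h
  rw [h]
  rcases x with _ | _ | x <;> rcases y with _ | _ | _ | y <;> rfl

theorem tokens_eq_of_configuration_eq {m n : ℕ} (hm : 3 ≤ m) (hn : 3 ≤ n)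
    (s : SystemState Color 6 m n)
    (hs : SystemState.configuration s = initialConfiguration m n) :
    SystemState.tokens s = place 0 0 initialPattern := by
  refine eq_of_colorsIn_eq fun x y => ?_
  by_cases h : x < m ∧ y < n
  · have h1 := SystemState.configuration_apply s (⟨x, h.1⟩, ⟨y, h.2⟩)
    rw [hs, ← colorsIn_initialPattern] at h1
    exact h1.symm
  -- Coordinates outside the grid carry no robot of `s`, and no token of the pattern, which fits
  -- into three rows and three columns.
  · rw [colorsIn_eq_zero, colorsIn_eq_zero]
    · intro p hp
      obtain ⟨q, hq, rfl⟩ := mem_place.1 hp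
      have : q.1 < 3 ∧ q.2.1 < 3 := inBox_iff.1 (by decide : inBox 3 3 initialPattern = true) q hq
      simp only [shift]
      omega
    · intro p hp
      obtain ⟨r, -, rfl⟩ := Multiset.mem_map.1 hp
      have h1 := (s r).pos.1.isLt
      have h2 := (s r).pos.2.isLt
      simp only [RobotState.token]
      omega

end GridExploration

theorem mainTheorem8 :
    ∃ A : GridExploration.Algorithm GridExploration.Color,
      ∀ m n : ℕ, 3 ≤ m → 3 ≤ n →
        GridExploration.SolvesTerminatingExploration A 6
          (GridExploration.initialConfiguration m n) :=
  ⟨GridExploration.explorer, fun _ _ hm hn =>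
    GridExploration.solves_of_reach
      (GridExploration.tokens_eq_of_configuration_eq hm hn)
      (fun _ hx _ hy => GridExploration.visit hm hn hx hy)
      (GridExploration.exists_reach_idle hm hn)⟩
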